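/- Let $\mathcal H$ be a separable infinite-dimensional complex Hilbert space. A sequence $(f_n)_{n\ge 1}$ in $\mathcal H$ is a Schauder basis (briefly, a basis) if for every $x\in\mathcal H$ there is a unique sequence $(\alpha_n)_{n\ge 1}$ of complex numbers with $\sum_{n=1}^{k}\alpha_n f_n\to x$ in norm as $k\to\infty$; a basis is unconditional if all these expansions converge unconditionally, and conditional otherwise; it is quasinormal if $0<\inf_n\|f_n\|\le\sup_n\|f_n\|<\infty$. A bounded operator on $\mathcal H$ is invertible if it has a bounded inverse, and it is generating if it maps some orthonormal basis $(e_n)_{n\ge1}$ onto a quasinormal conditional basis $(Te_n)_{n\ge1}$. **Theorem.** 1. If $A$ is a bounded linear operator on $\mathcal H$ such that $(Ae_n)_{n\ge1}$ is a Schauder basis of $\mathcal H$ for every orthonormal basis $(e_n)_{n\ge1}$ of $\mathcal H$, then $A$ is invertible. 2. Consequently, if a bounded linear operator $T$ on $\mathcal H$ is not invertible, then there is an orthonormal basis $(e_n)_{n\ge1}$ of $\mathcal H$ such that $(Te_n)_{n\ge1}$ is not a Schauder basis. 3. In particular, a generating operator $T$ on $\mathcal H$ is not invertible, and there is an orthonormal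 basis $(e_n)_{n\ge1}$ of $\mathcal H$ such that $(Te_n)_{n\ge1}$ is not a Schauder basis. -/

import Mathlib

open Filter Topology

/-- A sequence `f` in a complex normed space is a *Schauder basis* if every vector `x` has exactly
one sequence of coefficients `α` for which the partial sums `∑_{n<k} α n • f n` converge in norm
to `x`. -/
def IsSchauderBasis {H : Type*} [NormedAddCommGroup H] [NormedSpace ℂ H] (f : ℕ → H) : Prop :=
  ∀ x : H, ∃! α : ℕ → ℂ, Tendsto (fun k => ∑ n ∈ Finset.range k, α n • f n) atTop (𝓝 x)

/-- A Schauder basis is *unconditional* if the basis expansion of every vector converges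
unconditionally. -/
def IsUnconditionalBasis {H : Type*} [NormedAddCommGroup H] [NormedSpace ℂ H]
    (f : ℕ → H) : Prop :=
  IsSchauderBasis f ∧ ∀ (x : H) (α : ℕ → ℂ),
    Tendsto (fun k => ∑ n ∈ Finset.range k, α n • f n) atTop (𝓝 x) →
      HasSum (fun n => α n • f n) x

/-- A *conditional* basis is a Schauder basis that is not unconditional. -/
def IsConditionalBasis {H : Type*} [NormedAddCommGroup H] [NormedSpace ℂ H]
    (f : ℕ → H) : Prop :=
  IsSchauderBasis f ∧ ¬ IsUnconditionalBasis f

/-- A sequence is *quasinormal* if its norms are bounded above and bounded away from zero. -/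
def IsQuasinormal {H : Type*} [NormedAddCommGroup H] (f : ℕ → H) : Prop :=
  ∃ m M : ℝ, 0 < m ∧ ∀ n, m ≤ ‖f n‖ ∧ ‖f n‖ ≤ M

/-- A bounded operator is *generating* if it maps some orthonormal basis onto a quasinormal
conditional basis. -/
def IsGenerating {H : Type*} [NormedAddCommGroup H] [InnerProductSpace ℂ H]
    (T : H →L[ℂ] H) : Prop :=
  ∃ e : HilbertBasis ℕ ℂ H,
    IsConditionalBasis (fun n => T (e n)) ∧ IsQuasinormal (fun n => T (e n))

/-! Distinct vectors of a basis cannot be relatively close: bounded coordinate projections give `‖f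
i‖ ≤ K * ‖f i - f j‖`. Suppose `A` maps orthonormal bases to bases but is not invertible. It is
injective with dense range, so its range is not closed and it is not bounded below on any subspace
of finite codimension. Given a unit vector `u`, choose a unit `v ⟂ u` with `A v` tiny: `(u ± v)/√2`
are orthonormal with almost equal images. Mutually orthogonal pairs of this kind, with ever larger
ratios, extend to one orthonormal basis, whose image violates the inequality for every `K`. -/

/-- The coordinate projections of a Schauder basis of a Banach space are uniformly bounded. -/
theorem IsSchauderBasis.exists_norm_smul_le {H : Type*} [NormedAddCommGroup H] [NormedSpace ℂ H]
    [CompleteSpace H] {f : ℕ → H} (hf : IsSchauderBasis f) :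
    ∃ K : ℝ, ∀ (x : H) (α : ℕ → ℂ),
      Tendsto (fun k => ∑ n ∈ Finset.range k, α n • f n) atTop (𝓝 x) →
        ∀ n, ‖α n • f n‖ ≤ K * ‖x‖ := by
  let ev (p : OnePoint ℕ) : C(OnePoint ℕ, H) →L[ℂ] H := ContinuousMap.evalCLM ℂ p
  -- the space of convergent expansions with the supremum norm of the partial sums
  let E : Submodule ℂ C(OnePoint ℕ, H) :=
    (ev ((0 : ℕ) : OnePoint ℕ)).ker ⊓
      ⨅ n : ℕ, (Submodule.span ℂ {f n}).comap
        (ev ((n + 1 : ℕ) : OnePoint ℕ) - ev (n : OnePoint ℕ)).toLinearMap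
  have hE : IsClosed (E : Set C(OnePoint ℕ, H)) := by
    simp only [E, Submodule.coe_inf, Submodule.coe_iInf]
    exact (ContinuousLinearMap.isClosed_ker _).inter <| isClosed_iInter fun n =>
      (Submodule.closed_of_finiteDimensional (Submodule.span ℂ {f n})).preimage
        (ev ((n + 1 : ℕ) : OnePoint ℕ) - ev (n : OnePoint ℕ)).continuous
  have : CompleteSpace E := hE.completeSpace_coe
  let L : E →L[ℂ] H := (ev OnePoint.infty).comp E.subtypeL
  have hL : Function.Surjective L := fun x => by
    obtain ⟨α, hα, -⟩ := hf x
    refine ⟨⟨OnePoint.continuousMapMkNat _ x hα, ?_, ?_⟩, rfl⟩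
    · change ∑ n ∈ Finset.range 0, α n • f n = 0
      simp
    · refine (Submodule.mem_iInf _).2 fun n => Submodule.mem_span_singleton.2 ⟨α n, ?_⟩
      change _ = ∑ i ∈ Finset.range (n + 1), α i • f i - ∑ i ∈ Finset.range n, α i • f i
      rw [Finset.sum_range_succ, add_sub_cancel_left]
  -- Open mapping theorem. The factor 2 below arises because each term is a difference of two
  -- consecutive partial sums.
  obtain ⟨C, -, hC⟩ := L.exists_preimage_norm_le hL
  refine ⟨2 * C, fun x α hα n => ?_⟩
  obtain ⟨s, hsx, hs⟩ := hC x
  have h0 : s.1 ((0 : ℕ) : OnePoint ℕ) = 0 := s.2.1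
  have hstep (n : ℕ) : ∃ a : ℂ, a • f n = s.1 ((n + 1 : ℕ) : OnePoint ℕ) - s.1 (n : OnePoint ℕ) :=
    Submodule.mem_span_singleton.1 ((Submodule.mem_iInf _).1 s.2.2 n)
  choose β hβ using hstep
  have hsum (k : ℕ) : ∑ n ∈ Finset.range k, β n • f n = s.1 (k : OnePoint ℕ) := by
    simp_rw [hβ]
    rw [Finset.sum_range_sub (fun n : ℕ => s.1 (n : OnePoint ℕ)), h0, sub_zero]
  have hlim : Tendsto (fun k => ∑ n ∈ Finset.range k, β n • f n) atTop (𝓝 x) := by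
    simp_rw [hsum, ← hsx]
    exact (OnePoint.continuous_iff_from_nat s.1).1 s.1.continuous
  rw [(hf x).unique hα hlim, hβ]
  have h1 := s.1.norm_coe_le_norm ((n + 1 : ℕ) : OnePoint ℕ)
  have h2 := s.1.norm_coe_le_norm (n : OnePoint ℕ)
  have h3 := norm_sub_le (s.1 ((n + 1 : ℕ) : OnePoint ℕ)) (s.1 (n : OnePoint ℕ))
  have h4 : ‖s.1‖ ≤ C * ‖x‖ := hs
  linarith

/-- A vector of a Schauder basis is bounded by its distance to any other basis vector, up to a
uniform constant. -/
theorem IsSchauderBasis.exists_norm_le_norm_sub {H : Type*} [NormedAddCommGroup H]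
    [NormedSpace ℂ H] [CompleteSpace H] {f : ℕ → H} (hf : IsSchauderBasis f) :
    ∃ K : ℝ, ∀ i j, i ≠ j → ‖f i‖ ≤ K * ‖f i - f j‖ := by
  obtain ⟨K, hK⟩ := hf.exists_norm_smul_le
  refine ⟨K, fun i j hij => ?_⟩
  -- `f i - f j` has coefficients 1 at `i` and -1 at `j`, so its `i`-th term is `f i`.
  have h := hK (f i - f j) (Pi.single i 1 - Pi.single j 1) ?_ i
  · simpa [Pi.single_eq_of_ne hij] using h
  · refine tendsto_const_nhds.congr' ?_
    filter_upwards [eventually_gt_atTop i, eventually_gt_atTop j] with k hi hj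
    simp [sub_smul, Pi.single_apply, ite_smul, hi, hj]

/-- In a separable infinite-dimensional Hilbert space every orthonormal set is contained in the
range of a Hilbert basis indexed by `ℕ`. -/
theorem Orthonormal.exists_hilbertBasis_nat {H : Type*} [NormedAddCommGroup H]
    [InnerProductSpace ℂ H] [CompleteSpace H] [TopologicalSpace.SeparableSpace H]
    (hH : ¬ FiniteDimensional ℂ H) {s : Set H} (hs : Orthonormal ℂ ((↑) : s → H)) :
    ∃ e : HilbertBasis ℕ ℂ H, s ⊆ Set.range e := by
  obtain ⟨w, b, hsw, hb⟩ := hs.exists_hilbertBasis_extension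
  have hw : Orthonormal ℂ ((↑) : w → H) := hb ▸ b.orthonormal
  have : Infinite w := by
    by_contra hfin
    rw [not_infinite_iff_finite] at hfin
    have := Fintype.ofFinite w
    exact hH b.toOrthonormalBasis.toBasis.finiteDimensional_of_finite
  -- Orthonormal vectors lie √2 apart, so separability forces `w` to be countable.
  have hdisj : Pairwise (Function.onFun Disjoint fun x : w => Metric.ball (x : H) (1 / 2)) := by
    intro x y hxy
    refine Metric.ball_disjoint_ball ?_
    have h : ‖(x : H) - y‖ * ‖(x : H) - y‖ = 2 := by
      rw [norm_sub_mul_self (𝕜 := ℂ), hw.2 hxy, hw.1, hw.1]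
      norm_num
    rw [dist_eq_norm]
    nlinarith [norm_nonneg ((x : H) - y)]
  have : Countable w := hdisj.countable_of_isOpen_disjoint (fun _ => Metric.isOpen_ball)
    fun _ => Metric.nonempty_ball.2 (by norm_num)
  obtain ⟨φ⟩ := nonempty_equiv_of_countable (α := ℕ) (β := w)
  have hrange : Set.range (fun n => (φ n : H)) = Set.range b := by
    rw [hb]
    exact φ.surjective.range_comp _
  refine ⟨HilbertBasis.mk (hw.comp φ φ.injective) ?_, ?_⟩
  · change ⊤ ≤ (Submodule.span ℂ (Set.range fun n => (φ n : H))).topologicalClosure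
    rw [hrange, b.dense_span]
  · rw [HilbertBasis.coe_mk]
    exact fun x hx => ⟨φ.symm ⟨x, hsw hx⟩, by simp⟩

/-- The expansion of a kernel vector is mapped to an expansion of 0, which is unique. -/
theorem HilbertBasis.injective_of_isSchauderBasis {H : Type*} [NormedAddCommGroup H]
    [InnerProductSpace ℂ H] {A : H →L[ℂ] H} (e : HilbertBasis ℕ ℂ H)
    (hA : IsSchauderBasis fun n => A (e n)) : Function.Injective A := by
  rw [injective_iff_map_eq_zero]
  intro x hx
  have h1 : Tendsto (fun k => ∑ n ∈ Finset.range k, e.repr x n • A (e n)) atTop (𝓝 0) := by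
    have := (A.hasSum (e.hasSum_repr x)).tendsto_sum_nat
    simpa [hx] using this
  have h2 : Tendsto (fun k => ∑ n ∈ Finset.range k, (0 : ℕ → ℂ) n • A (e n)) atTop (𝓝 0) := by
    simp
  have h3 := (hA 0).unique h1 h2
  refine e.repr.map_eq_zero_iff.1 (lp.ext h3)

theorem HilbertBasis.denseRange_of_isSchauderBasis {H : Type*} [NormedAddCommGroup H]
    [InnerProductSpace ℂ H] {A : H →L[ℂ] H} (e : HilbertBasis ℕ ℂ H)
    (hA : IsSchauderBasis fun n => A (e n)) : DenseRange A := fun x => by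
  obtain ⟨α, hα, -⟩ := hA x
  exact mem_closure_of_tendsto hα <| Eventually.of_forall fun k =>
    ⟨∑ n ∈ Finset.range k, α n • e n, by simp⟩

/-- If an injective operator with dense range is not invertible, then it is not bounded below on
any subspace of finite codimension. -/
theorem ContinuousLinearMap.exists_mem_orthogonal_norm_lt {H : Type*} [NormedAddCommGroup H]
    [InnerProductSpace ℂ H] [CompleteSpace H] {A : H →L[ℂ] H} (hinj : Function.Injective A)
    (hdense : DenseRange A) (hA : ¬ IsUnit A) (V : Submodule ℂ H) [FiniteDimensional ℂ V]
    {ε : ℝ} (hε : 0 < ε) : ∃ v ∈ Vᗮ, ‖v‖ = 1 ∧ ‖A v‖ < ε := by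
  by_contra! h
  apply hA
  have hbound (v : Vᗮ) : ‖v‖ ≤ (⟨ε⁻¹, by positivity⟩ : NNReal) * ‖(A.comp Vᗮ.subtypeL) v‖ := by
    rcases eq_or_ne v 0 with rfl | hv
    · simp
    have hv' : (v : H) ≠ 0 := by simpa using hv
    have hpos := norm_pos_iff.2 hv'
    have := h (((‖(v : H)‖⁻¹ : ℝ) : ℂ) • (v : H)) (Vᗮ.smul_mem _ v.2)
      (by rw [norm_smul, Complex.norm_real, norm_inv, norm_norm, inv_mul_cancel₀ hpos.ne'])
    rw [map_smul, norm_smul, Complex.norm_real, norm_inv, norm_norm, inv_mul_eq_div,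
      le_div_iff₀ hpos] at this
    change ‖(v : H)‖ ≤ ε⁻¹ * ‖A v‖
    rwa [inv_mul_eq_div, le_div_iff₀ hε, mul_comm]
  have hcl : IsClosed (Vᗮ.map A.toLinearMap : Set H) := by
    have := ((A.comp Vᗮ.subtypeL).antilipschitz_of_bound hbound).isClosed_range
      (A.comp Vᗮ.subtypeL).uniformContinuous
    convert this using 1
    ext x
    simp
  -- The range is the closed `A(Vᗮ)` plus the finite-dimensional `A(V)`.
  have hrange : IsClosed (Set.range A) := by
    have := Submodule.isClosed_sup_finiteDimensional _ (V.map A.toLinearMap) hcl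
    rw [← Submodule.map_sup, sup_comm, Submodule.sup_orthogonal_of_hasOrthogonalProjection,
      Submodule.map_top] at this
    exact this
  rw [ContinuousLinearMap.isUnit_iff_bijective]
  refine ⟨hinj, Set.range_eq_univ.1 ?_⟩
  rw [← hrange.closure_eq, hdense.closure_range]

/-- If an injective operator with dense range is not invertible, then orthogonally to any
finite-dimensional subspace there are orthonormal pairs whose images are relatively arbitrarily
close. -/
theorem ContinuousLinearMap.exists_orthonormal_pair {H : Type*} [NormedAddCommGroup H]
    [InnerProductSpace ℂ H] [CompleteSpace H] {A : H →L[ℂ] H} (hinj : Function.Injective A)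
    (hdense : DenseRange A) (hA : ¬ IsUnit A) (V : Submodule ℂ H) [FiniteDimensional ℂ V]
    {c : ℝ} (hc : 0 ≤ c) :
    ∃ p ∈ Vᗮ, ∃ q ∈ Vᗮ, ‖p‖ = 1 ∧ ‖q‖ = 1 ∧ inner ℂ p q = 0 ∧ c * ‖A (p - q)‖ < ‖A p‖ := by
  obtain ⟨u, huV, hu, -⟩ := A.exists_mem_orthogonal_norm_lt hinj hdense hA V one_pos
  have hAu : 0 < ‖A u‖ := by
    rw [norm_pos_iff, Ne, map_eq_zero_iff A hinj, ← norm_eq_zero, hu]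
    exact one_ne_zero
  -- With `p, q = r • (u ± v)`, `‖A (p - q)‖ = 2r‖A v‖` and `‖A p‖ ≥ r(‖A u‖ - ‖A v‖)`, so `(2c +
  -- 1)‖A v‖ < ‖A u‖` suffices.
  obtain ⟨v, hvW, hv, hAv⟩ := A.exists_mem_orthogonal_norm_lt hinj hdense hA
    (V ⊔ Submodule.span ℂ {u}) (ε := ‖A u‖ / (2 * c + 1)) (by positivity)
  have hvV : v ∈ Vᗮ := Submodule.orthogonal_le le_sup_left hvW
  have huv : inner ℂ u v = 0 :=
    hvW u (Submodule.mem_sup_right (Submodule.mem_span_singleton_self u))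
  have hvu : inner ℂ v u = 0 := inner_eq_zero_symm.1 huv
  rw [lt_div_iff₀ (by positivity)] at hAv
  let r : ℂ := ((√2)⁻¹ : ℝ)
  have hr : ‖r‖ = (√2)⁻¹ := by simp [r, abs_of_nonneg]
  have hr0 : 0 < ‖r‖ := by rw [hr]; positivity
  have hnorm : √2 * √2 = (2 : ℝ) := Real.mul_self_sqrt (by norm_num)
  have hadd : ‖u + v‖ = √2 := by
    rw [← mul_self_inj (norm_nonneg _) (by positivity), hnorm,
      norm_add_sq_eq_norm_sq_add_norm_sq_of_inner_eq_zero u v huv, hu, hv]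
    norm_num
  have hsub : ‖u - v‖ = √2 := by
    rw [← mul_self_inj (norm_nonneg _) (by positivity), hnorm, sub_eq_add_neg,
      norm_add_sq_eq_norm_sq_add_norm_sq_of_inner_eq_zero (𝕜 := ℂ) u (-v) (by simp [huv]), norm_neg, hu, hv]
    norm_num
  refine ⟨r • (u + v), Vᗮ.smul_mem _ (Vᗮ.add_mem huV hvV),
    r • (u - v), Vᗮ.smul_mem _ (Vᗮ.sub_mem huV hvV), ?_, ?_, ?_, ?_⟩
  · rw [norm_smul, hr, hadd, inv_mul_cancel₀ (by positivity)]
  · rw [norm_smul, hr, hsub, inv_mul_cancel₀ (by positivity)]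
  · simp [huv, hvu, inner_self_eq_norm_sq_to_K, hu, hv]
  · rw [← smul_sub, map_smul, map_smul, norm_smul, norm_smul, mul_left_comm]
    refine mul_lt_mul_of_pos_left ?_ hr0
    have h1 : A (u + v - (u - v)) = A v + A v := by rw [← map_add]; congr 1; abel
    have h2 := norm_add_le (A v) (A v)
    have h3 := norm_sub_le (A (u + v)) (A v)
    rw [← map_sub, add_sub_cancel_right] at h3
    rw [h1]
    nlinarith [mul_le_mul_of_nonneg_left h2 hc]

/-- If an injective operator with dense range is not invertible, then there is an orthonormal set
containing pairs whose images are relatively arbitrarily close. -/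
theorem ContinuousLinearMap.exists_orthonormal_set {H : Type*} [NormedAddCommGroup H]
    [InnerProductSpace ℂ H] [CompleteSpace H] {A : H →L[ℂ] H} (hinj : Function.Injective A)
    (hdense : DenseRange A) (hA : ¬ IsUnit A) :
    ∃ s : Set H, Orthonormal ℂ ((↑) : s → H) ∧
      ∀ c : ℝ, ∃ p ∈ s, ∃ q ∈ s, p ≠ q ∧ c * ‖A (p - q)‖ < ‖A p‖ := by
  classical
  -- The natural number is the ratio demanded of the pair; `R` makes it increase strictly, hence
  -- without bound.
  let P : ℕ × H × H → Prop := fun x => ‖x.2.1‖ = 1 ∧ ‖x.2.2‖ = 1 ∧ inner ℂ x.2.1 x.2.2 = 0 ∧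
    x.1 * ‖A (x.2.1 - x.2.2)‖ < ‖A x.2.1‖
  let R : ℕ × H × H → ℕ × H × H → Prop := fun x y => x.1 < y.1 ∧
    ∀ a ∈ ({x.2.1, x.2.2} : Set H), ∀ b ∈ ({y.2.1, y.2.2} : Set H), inner ℂ a b = 0
  obtain ⟨f, hP, hR⟩ := exists_seq_of_forall_finset_exists P R fun t _ => by
    let F : Finset H := t.image (fun x => x.2.1) ∪ t.image (fun x => x.2.2)
    let N : ℕ := t.sup (fun x => x.1) + 1
    obtain ⟨p, hp, q, hq, h⟩ := A.exists_orthonormal_pair hinj hdense hA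
      (Submodule.span ℂ (F : Set H)) (Nat.cast_nonneg N)
    refine ⟨(N, p, q), h, fun x hx => ⟨Nat.lt_succ_of_le (Finset.le_sup (f := fun x => x.1) hx), ?_⟩⟩
    intro a ha b hb
    have haF : a ∈ Submodule.span ℂ (F : Set H) := by
      apply Submodule.subset_span
      rcases ha with rfl | rfl
      · exact Finset.mem_union_left _ (Finset.mem_image_of_mem (fun x => x.2.1) hx)
      · exact Finset.mem_union_right _ (Finset.mem_image_of_mem (fun x => x.2.2) hx)
    rcases hb with rfl | rfl
    · exact hp a haF
    · exact hq a haF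
  have hmono : StrictMono fun n => (f n).1 := fun m n h => (hR m n h).1
  refine ⟨⋃ n, {(f n).2.1, (f n).2.2}, ⟨?_, ?_⟩, fun c => ?_⟩
  · rintro ⟨x, hx⟩
    obtain ⟨n, rfl | rfl⟩ := Set.mem_iUnion.1 hx
    · exact (hP n).1
    · exact (hP n).2.1
  · rintro ⟨x, hx⟩ ⟨y, hy⟩ hxy
    have hxy' : x ≠ y := fun h => hxy (Subtype.ext h)
    obtain ⟨m, hm⟩ := Set.mem_iUnion.1 hx
    obtain ⟨n, hn⟩ := Set.mem_iUnion.1 hy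
    change inner ℂ x y = 0
    rcases lt_trichotomy m n with h | rfl | h
    · exact (hR m n h).2 x hm y hn
    · rcases hm with rfl | rfl <;> rcases hn with rfl | rfl
      · exact absurd rfl hxy'
      · exact (hP m).2.2.1
      · exact inner_eq_zero_symm.1 (hP m).2.2.1
      · exact absurd rfl hxy'
    · exact inner_eq_zero_symm.1 ((hR n m h).2 y hn x hm)
  · obtain ⟨n, hn⟩ := exists_nat_ge c
    obtain ⟨h1, -, h3, h4⟩ := hP n
    refine ⟨_, Set.mem_iUnion.2 ⟨n, Or.inl rfl⟩, _, Set.mem_iUnion.2 ⟨n, Or.inr rfl⟩, ?_, ?_⟩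
    · intro h
      rw [← h, inner_self_eq_zero, ← norm_eq_zero, h1] at h3
      exact one_ne_zero h3
    · refine lt_of_le_of_lt (mul_le_mul_of_nonneg_right (hn.trans ?_) (norm_nonneg _)) h4
      exact_mod_cast hmono.id_le n

/-- An operator mapping every Hilbert basis to a Schauder basis is invertible. -/
theorem ContinuousLinearMap.isUnit_of_forall_isSchauderBasis {H : Type*} [NormedAddCommGroup H]
    [InnerProductSpace ℂ H] [CompleteSpace H] [TopologicalSpace.SeparableSpace H]
    (hH : ¬ FiniteDimensional ℂ H) (A : H →L[ℂ] H)
    (h : ∀ e : HilbertBasis ℕ ℂ H, IsSchauderBasis fun n => A (e n)) : IsUnit A := by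
  by_contra hA
  obtain ⟨e₀, -⟩ := (orthonormal_empty ℂ H).exists_hilbertBasis_nat hH
  obtain ⟨s, hs, hpairs⟩ := A.exists_orthonormal_set (e₀.injective_of_isSchauderBasis (h e₀))
    (e₀.denseRange_of_isSchauderBasis (h e₀)) hA
  obtain ⟨e, he⟩ := hs.exists_hilbertBasis_nat hH
  obtain ⟨K, hK⟩ := (h e).exists_norm_le_norm_sub
  obtain ⟨p, hp, q, hq, hpq, hlt⟩ := hpairs K
  obtain ⟨i, rfl⟩ := he hp
  obtain ⟨j, rfl⟩ := he hq
  rw [map_sub] at hlt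
  exact hlt.not_ge (hK i j fun hij => hpq (congrArg e hij))

/-- The image of a Hilbert basis under an invertible operator is unconditional as soon as it is a
Schauder basis. -/
theorem HilbertBasis.isUnconditionalBasis_of_isUnit {H : Type*} [NormedAddCommGroup H]
    [InnerProductSpace ℂ H] {T : H →L[ℂ] H} (hT : IsUnit T) (e : HilbertBasis ℕ ℂ H)
    (he : IsSchauderBasis fun n => T (e n)) : IsUnconditionalBasis fun n => T (e n) := by
  refine ⟨he, fun x α hα => ?_⟩
  obtain ⟨S, hS⟩ := hT.exists_right_inv
  have hsum : HasSum (fun n => e.repr (S x) n • T (e n)) x := by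
    have hTS : T (S x) = x := DFunLike.congr_fun hS x
    simpa [hTS] using T.hasSum (e.hasSum_repr (S x))
  rwa [(he x).unique hα hsum.tendsto_sum_nat]

theorem mainTheorem6 {H : Type*} [NormedAddCommGroup H] [InnerProductSpace ℂ H]
    [CompleteSpace H] [TopologicalSpace.SeparableSpace H] (hH : ¬ FiniteDimensional ℂ H) :
    (∀ A : H →L[ℂ] H,
      (∀ e : HilbertBasis ℕ ℂ H, IsSchauderBasis (fun n => A (e n))) → IsUnit A) ∧
    (∀ T : H →L[ℂ] H, ¬ IsUnit T →
      ∃ e : HilbertBasis ℕ ℂ H, ¬ IsSchauderBasis (fun n => T (e n))) ∧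
    (∀ T : H →L[ℂ] H, IsGenerating T →
      ¬ IsUnit T ∧ ∃ e : HilbertBasis ℕ ℂ H, ¬ IsSchauderBasis (fun n => T (e n))) := by
  have main : ∀ T : H →L[ℂ] H, ¬ IsUnit T →
      ∃ e : HilbertBasis ℕ ℂ H, ¬ IsSchauderBasis (fun n => T (e n)) := fun T hT => by
    by_contra! h
    exact hT (T.isUnit_of_forall_isSchauderBasis hH h)
  refine ⟨fun A => A.isUnit_of_forall_isSchauderBasis hH, main, fun T ⟨e, he, _⟩ => ?_⟩
  have hT : ¬ IsUnit T := fun hT => he.2 (e.isUnconditionalBasis_of_isUnit hT he.1)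
  exact ⟨hT, main T hT⟩
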